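/- Let $d\ge 1$, $N \ge 1$. Let $\mathcal C_N^{(d)}=\{x\in\mathbb Z^d: 1-\lfloor N/2\rfloor\le x_i\le \lceil N/2\rceil \text{ for all } i\}$ be the hypercube of side $N$. Start with $s_0^{(d,N)}\equiv 2d$ chips on every site of $\mathcal C_N^{(d)}$ and topple in parallel: with $v_0^{(d,N)}\equiv 0$, $$v_{t+1}^{(d,N)}=v_t^{(d,N)}+1\{s_t^{(d,N)}\ge 2d\},\qquad s_{t+1}^{(d,N)}=s_t^{(d,N)}+\Delta\big(v_{t+1}^{(d,N)}-v_t^{(d,N)}\big)\quad\text{on }\mathcal C_N^{(d)},$$ where $\Delta f(x)=-2d\,f(x)+\sum_{|y-x|_1=1}f(y)$ and $f:=0$ off $\mathcal C_N^{(d)}$. After finitely many steps every site has fewer than $2d$ chips and the process stops; $s_\infty^{(d,N)}$ denotes the terminal sandpile. For $M=\lceil N/2\rceil$ let $\mathcal S_M^{(d)}=\{x\in\mathbb Z^d: M\ge x_1\ge\dots\ge x_d\ge 1\}$. For $j\ge 1$ let $$\tau_j=\min\{t\ge 1:\ v_t^{(d,2j)}(x)\ge j\text{ for some }x\in\partial\mathcal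 C_{2j}^{(d)}\},$$ where $\partial\mathcal C_{2j}^{(d)}$ is the set of sites of $\mathcal C_{2j}^{(d)}$ that have a nearest neighbor outside it. Now let $N\ge 1$, $d\ge 2$ and $M=\lceil N/2\rceil$. Inequalities and differences between vectors and scalars are coordinatewise. 1. (Dimensional reduction) For all $\mathbf x_{d-1}\in\mathcal S_M^{(d-1)}$ with $\mathbf x_{d-1}\ge 2$, $$s_\infty^{(d,N)}(\mathbf x_{d-1},1)=s_\infty^{(d-1,N)}(\mathbf x_{d-1})+2 .$$ 2. (Self-similarity) For all $1\le j<M$, the minimum defining $\tau_j$ (in dimension $d$) exists, and for all $0\le t\le\tau_j$ and $\mathbf x\in\mathcal S_M^{(d)}$ with $\mathbf x>M-j+1$, $$s_t^{(d,N)}(\mathbf x)=s_t^{(d,2j)}(\mathbf x-(M-j)).$$ -/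

import Mathlib

/-- The side length `N` hypercube `C_N^{(d)}` of `ℤ^d`, with the coordinates of its sites running
from `1 - ⌊N/2⌋` to `⌈N/2⌉`.  (See `Sandpile.mem_cube_even`, `Sandpile.mem_cube_odd`.) -/
def Sandpile.cube (d N : ℕ) : Set (Fin d → ℤ) :=
  {x | ∀ i, 1 - ((N / 2 : ℕ) : ℤ) ≤ x i ∧ x i ≤ (((N + 1) / 2 : ℕ) : ℤ)}

/-- `C_{2k}^{(d)} = { x - k : 1 ≤ x_i ≤ 2k }`. -/
theorem Sandpile.mem_cube_even (d k : ℕ) (x : Fin d → ℤ) :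
    x ∈ Sandpile.cube d (2 * k) ↔ ∀ i, 1 ≤ x i + k ∧ x i + k ≤ 2 * k := by
  simp only [Sandpile.cube, Set.mem_ofPred_eq]
  exact forall_congr' fun i => by omega

/-- `C_{2k+1}^{(d)} = { x + 1 : |x_i| ≤ k }`. -/
theorem Sandpile.mem_cube_odd (d k : ℕ) (x : Fin d → ℤ) :
    x ∈ Sandpile.cube d (2 * k + 1) ↔ ∀ i, |x i - 1| ≤ k := by
  simp only [Sandpile.cube, Set.mem_ofPred_eq, abs_le]
  exact forall_congr' fun i => by omega

/-- The inner boundary of the cube: the sites with an `ℓ¹`-neighbour outside the cube. -/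
def Sandpile.cubeBoundary (d N : ℕ) : Set (Fin d → ℤ) :=
  {x | x ∈ Sandpile.cube d N ∧ ∃ y, y ∉ Sandpile.cube d N ∧ ∑ i, |y i - x i| = 1}

/-- The sorted fundamental domain `S_M^{(d)} = { x : M ≥ x_1 ≥ ⋯ ≥ x_d ≥ 1 }`. -/
def Sandpile.sortedDomain (d M : ℕ) : Set (Fin d → ℤ) :=
  {x | (∀ i, 1 ≤ x i ∧ x i ≤ M) ∧ Antitone x}

/-- The nearest-neighbour graph Laplacian of `ℤ^d`.  Applied to functions that vanish off the cube
and evaluated on the cube, it is the Laplacian with dissipating boundary conditions. -/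
def Sandpile.laplacian (d : ℕ) (f : (Fin d → ℤ) → ℤ) (x : Fin d → ℤ) : ℤ :=
  -(2 * d) * f x + ∑ i, (f (x + Pi.single i 1) + f (x - Pi.single i 1))

open Classical in
/-- The indicator of the set of unstable sites of the cube: those with at least `2d` chips. -/
noncomputable def Sandpile.unstable (d N : ℕ) (s : (Fin d → ℤ) → ℤ) (x : Fin d → ℤ) : ℤ :=
  if x ∈ Sandpile.cube d N ∧ 2 * (d : ℤ) ≤ s x then 1 else 0

/-- The parallel toppling sandpile `s_t^{(d,N)}` started from `2d` chips on every site of the cube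
(a function on the cube, extended by `0`): all unstable sites topple simultaneously. -/
noncomputable def Sandpile.sandpile (d N : ℕ) : ℕ → (Fin d → ℤ) → ℤ
  | 0 => (Sandpile.cube d N).indicator fun _ => 2 * (d : ℤ)
  | t + 1 => (Sandpile.cube d N).indicator fun x =>
      Sandpile.sandpile d N t x +
        Sandpile.laplacian d (Sandpile.unstable d N (Sandpile.sandpile d N t)) x

/-- The odometer `v_t^{(d,N)}`: the number of topplings of each site before time `t`
(extended by `0` off the cube). -/
noncomputable def Sandpile.odometer (d N : ℕ) : ℕ → (Fin d → ℤ) → ℤ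
  | 0 => fun _ => 0
  | t + 1 => fun x =>
      Sandpile.odometer d N t x + Sandpile.unstable d N (Sandpile.sandpile d N t) x

/-- The times at which every site of the cube is stable. -/
def Sandpile.stableTimes (d N : ℕ) : Set ℕ :=
  {t | ∀ x ∈ Sandpile.cube d N, Sandpile.sandpile d N t x < 2 * (d : ℤ)}

/-- The terminal sandpile `s_∞^{(d,N)}`: the sandpile at the first time at which every site is
stable, when the process stops.  Such a time exists for `d ≥ 1`, see
`Sandpile.stableTimes_nonempty`, and the sandpile is constant from then on, see
`Sandpile.sandpile_eq_terminal`. -/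
noncomputable def Sandpile.terminalSandpile (d N : ℕ) : (Fin d → ℤ) → ℤ :=
  Sandpile.sandpile d N (sInf (Sandpile.stableTimes d N))

/-- The times `t ≥ 1` at which some boundary site of the cube of side `2j` has toppled at least
`j` times. -/
def Sandpile.boundaryTimes (d j : ℕ) : Set ℕ :=
  {t | 1 ≤ t ∧ ∃ x ∈ Sandpile.cubeBoundary d (2 * j), (j : ℤ) ≤ Sandpile.odometer d (2 * j) t x}

/-- The time `τ_j = min { t ≥ 1 : v_t^{(d,2j)}(x) ≥ j for some x ∈ ∂C_{2j}^{(d)} }`. -/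
noncomputable def Sandpile.tau (d j : ℕ) : ℕ :=
  sInf (Sandpile.boundaryTimes d j)

theorem Sandpile.odometer_eq_zero (d N t : ℕ) (x : Fin d → ℤ) (hx : x ∉ Sandpile.cube d N) :
    Sandpile.odometer d N t x = 0 := by
  induction t with
  | zero => rfl
  | succ t ih => simp [Sandpile.odometer, Sandpile.unstable, ih, hx]

theorem Sandpile.sandpile_eq (d N t : ℕ) (x : Fin d → ℤ) (hx : x ∈ Sandpile.cube d N) :
    Sandpile.sandpile d N t x = 2 * d + Sandpile.laplacian d (Sandpile.odometer d N t) x := by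
  induction t with
  | zero => simp [Sandpile.sandpile, Sandpile.odometer, Sandpile.laplacian, hx]
  | succ t ih =>
    simp only [Sandpile.sandpile, Set.indicator_of_mem hx, ih, Sandpile.odometer,
      Sandpile.laplacian, Finset.sum_add_distrib]
    ring

theorem Sandpile.odometer_le (d N t : ℕ) (i₀ : Fin d) (x : Fin d → ℤ)
    (hx : ∀ i, |x i| ≤ N + 1) :
    Sandpile.odometer d N t x ≤ (N + 1) ^ 2 - x i₀ ^ 2 := by
  induction t generalizing x with
  | zero =>
    have := sq_le_sq' (abs_le.1 (hx i₀)).1 (abs_le.1 (hx i₀)).2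
    simp only [Sandpile.odometer]; linarith
  | succ t ih =>
    by_cases hu : x ∈ Sandpile.cube d N ∧ 2 * (d : ℤ) ≤ Sandpile.sandpile d N t x
    · obtain ⟨hc, hs⟩ := hu
      have hx' : ∀ i, |x i| ≤ N := fun i => by
        have := hc i
        rw [abs_le]; omega
      rw [Sandpile.sandpile_eq d N t x hc] at hs
      have hlap : 0 ≤ Sandpile.laplacian d (Sandpile.odometer d N t) x := by linarith
      simp only [Sandpile.odometer, Sandpile.unstable, hc,
        Sandpile.sandpile_eq d N t x hc, true_and, hs, if_true]
      by_contra hcon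
      have hv : Sandpile.odometer d N t x = (N + 1) ^ 2 - x i₀ ^ 2 := by
        have := ih x hx; omega
      have key : ∀ i, Sandpile.odometer d N t (x + Pi.single i 1)
          + Sandpile.odometer d N t (x - Pi.single i 1)
          ≤ 2 * ((N + 1) ^ 2 - x i₀ ^ 2) - (if i = i₀ then 2 else 0) := by
        intro i
        have h1 := ih (x + Pi.single i 1) (fun k => by
          have := hx' k
          rw [abs_le] at this ⊢
          by_cases hk : k = i
          · subst hk; simp; omega
          · simp [hk]; omega)
        have h2 := ih (x - Pi.single i 1) (fun k => by
          have := hx' k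
          rw [abs_le] at this ⊢
          by_cases hk : k = i
          · subst hk; simp; omega
          · simp [hk]; omega)
        by_cases hi : i = i₀
        · subst hi
          simp only [Pi.add_apply, Pi.sub_apply, Pi.single_eq_same, if_true] at h1 h2 ⊢
          nlinarith
        · have hi' : i₀ ≠ i := fun h => hi h.symm
          simp only [Pi.add_apply, Pi.sub_apply, Pi.single_eq_of_ne hi', hi, if_false] at h1 h2 ⊢
          linarith
      have hsum := Finset.sum_le_sum (fun i (_ : i ∈ Finset.univ) => key i)
      simp only [Finset.sum_sub_distrib, Finset.sum_const, Finset.card_univ, Fintype.card_fin,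
        Finset.sum_ite_eq', Finset.mem_univ, if_true, nsmul_eq_mul] at hsum
      simp only [Sandpile.laplacian, hv] at hlap
      linarith
    · simp only [Sandpile.odometer, Sandpile.unstable, hu, if_false]
      linarith [ih x hx]

/-- The process stabilizes. -/
theorem Sandpile.stableTimes_nonempty (d N : ℕ) (hd : 1 ≤ d) :
    (Sandpile.stableTimes d N).Nonempty := by
  by_contra hne
  have hns : ∀ t, ∃ x ∈ Sandpile.cube d N, 2 * (d : ℤ) ≤ Sandpile.sandpile d N t x := by
    intro t
    by_contra h
    push Not at h
    exact hne ⟨t, h⟩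
  have hfin : (Sandpile.cube d N).Finite :=
    (Set.finite_Icc (fun _ : Fin d => 1 - ((N / 2 : ℕ) : ℤ))
      (fun _ => (((N + 1) / 2 : ℕ) : ℤ))).subset
        fun x hx => ⟨fun i => (hx i).1, fun i => (hx i).2⟩
  have hlow : ∀ t : ℕ, (t : ℤ) ≤ ∑ x ∈ hfin.toFinset, Sandpile.odometer d N t x := by
    intro t
    induction t with
    | zero => simp [Sandpile.odometer]
    | succ t ih =>
      obtain ⟨x, hx, hs⟩ := hns t
      have h1 : (1 : ℤ) ≤ ∑ x ∈ hfin.toFinset,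
          Sandpile.unstable d N (Sandpile.sandpile d N t) x := by
        refine le_trans ?_ (Finset.single_le_sum (fun y _ => ?_) (hfin.mem_toFinset.2 hx))
        · simp [Sandpile.unstable, hx, hs]
        · unfold Sandpile.unstable; split_ifs <;> simp
      simp only [Sandpile.odometer, Finset.sum_add_distrib]
      push_cast
      linarith
  have hup : ∀ t : ℕ, ∑ x ∈ hfin.toFinset, Sandpile.odometer d N t x
      ≤ ∑ x ∈ hfin.toFinset, ((N : ℤ) + 1) ^ 2 := by
    intro t
    refine Finset.sum_le_sum fun x hx => ?_
    have hc := hfin.mem_toFinset.1 hx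
    have := Sandpile.odometer_le d N t ⟨0, hd⟩ x (fun i => by
      have := hc i
      rw [abs_le]; omega)
    have := sq_nonneg (x ⟨0, hd⟩)
    linarith
  have h1 := hlow ((∑ x ∈ hfin.toFinset, ((N : ℤ) + 1) ^ 2).toNat + 1)
  have h2 := hup ((∑ x ∈ hfin.toFinset, ((N : ℤ) + 1) ^ 2).toNat + 1)
  omega

/-- Once every site is stable, the sandpile does not change any more. -/
theorem Sandpile.sandpile_eq_terminal (d N t : ℕ) (hd : 1 ≤ d)
    (ht : sInf (Sandpile.stableTimes d N) ≤ t) :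
    Sandpile.sandpile d N t = Sandpile.terminalSandpile d N := by
  have hst : ∀ x ∈ Sandpile.cube d N, Sandpile.terminalSandpile d N x < 2 * (d : ℤ) :=
    Nat.sInf_mem (Sandpile.stableTimes_nonempty d N hd)
  induction t, ht using Nat.le_induction with
  | base => rfl
  | succ t _ ih =>
    have hu : Sandpile.unstable d N (Sandpile.sandpile d N t) = fun _ => 0 := by
      funext x
      unfold Sandpile.unstable
      rw [if_neg]
      rintro ⟨hc, hs⟩
      rw [ih] at hs
      exact absurd (hst x hc) (not_lt.2 hs)
    funext x
    by_cases hx : x ∈ Sandpile.cube d N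
    · simp only [Sandpile.sandpile, Set.indicator_of_mem hx, hu, Sandpile.laplacian]
      simp [ih]
    · have h0 : Sandpile.sandpile d N t x = 0 := by
        cases t <;> simp [Sandpile.sandpile, hx]
      rw [← ih, h0]
      simp [Sandpile.sandpile, hx]

/-! On the cube `s_t = 2d + Δ v_t`, so a site topples exactly when the second differences of the
odometer there sum to at least `0`. As `v_t(x)` grows by `0` or `1` per step, an inequality between
two odometer values can only break from equality, and then it is enough that toppling on the left
forces toppling on the right (`odometer_succ_le_add`). Most estimates are inductions of this kind.
Those with a time delay also use that two consecutive topplings occur only during the initial wave,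
while a site has never rested (`odometer_eq_time_of_add_two`).

Dimensional reduction. At every time, the odometer in dimension `n + 1` on the layer of coordinate
`1` is the odometer in dimension `n` (`odometer_ins_one`). The lower bound has to be proved for all
layers at once: layer `m + 1` is compared with a delay `m` and a loss `m(m+1)/2`
(`odometer_le_ins_add`). After stabilization, layers `1` and `2` agree over sites with a coordinate
at least `2` (`odometer_le_succ_add_single`). The new direction then adds nothing to the Laplacian,
and only `2(n+1) - 2n = 2` remains.

Self-similarity. Put `a = M - j`. Up to time `τ_j`, the odometer of the large cube at a positive
site `x` with some coordinate above `a` is that of the cube of side `2j` at `clamp a x`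
(`odometer_eq_clamp`). In dimension one (`line_selfSimilar`) the central part of the large interval
is so flat that `a + 1` topples together with the site `1` of the small one. In higher dimension,
coordinates clamped to `1` drop out by dimensional reduction, and the one configuration escaping the
induction is squeezed by monotonicity. The time `τ_j` enters through the boundary site `(j, 1, …,
1)`, whose odometer is one-dimensional. -/

namespace Sandpile

/-! ### Toppling as a sign condition on second differences, and the one-step comparison. -/

/-- The second difference of `f` in the direction `i`. -/
def secondDiff {d : ℕ} (i : Fin d) (f : (Fin d → ℤ) → ℤ) (x : Fin d → ℤ) : ℤ :=
  f (x + Pi.single i 1) + f (x - Pi.single i 1) - 2 * f x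

theorem laplacian_eq_sum (d : ℕ) (f : (Fin d → ℤ) → ℤ) (x : Fin d → ℤ) :
    laplacian d f x = ∑ i, secondDiff i f x := by
  simp only [laplacian, secondDiff, Finset.sum_sub_distrib, Finset.sum_const, Finset.card_univ,
    Fintype.card_fin, nsmul_eq_mul]
  ring

/-- The site `x` topples at time `t`. -/
def Topples (d N t : ℕ) (x : Fin d → ℤ) : Prop :=
  x ∈ cube d N ∧ 0 ≤ ∑ i, secondDiff i (odometer d N t) x

theorem unstable_eq_one {d N t : ℕ} {x : Fin d → ℤ} (h : Topples d N t x) :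
    unstable d N (sandpile d N t) x = 1 := by
  have h1 := sandpile_eq d N t x h.1
  rw [laplacian_eq_sum] at h1
  have h2 := h.2
  rw [unstable, if_pos ⟨h.1, by linarith⟩]

theorem unstable_eq_zero {d N t : ℕ} {x : Fin d → ℤ} (h : ¬ Topples d N t x) :
    unstable d N (sandpile d N t) x = 0 := by
  rw [unstable, if_neg]
  rintro ⟨hc, hs⟩
  rw [sandpile_eq d N t x hc, laplacian_eq_sum] at hs
  exact h ⟨hc, by linarith⟩

theorem odometer_succ_of_topples {d N t : ℕ} {x : Fin d → ℤ} (h : Topples d N t x) :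
    odometer d N (t + 1) x = odometer d N t x + 1 := by
  simp only [odometer, unstable_eq_one h]

theorem odometer_succ_of_not_topples {d N t : ℕ} {x : Fin d → ℤ} (h : ¬ Topples d N t x) :
    odometer d N (t + 1) x = odometer d N t x := by
  simp only [odometer, unstable_eq_zero h, add_zero]

theorem odometer_succ_le (d N t : ℕ) (x : Fin d → ℤ) :
    odometer d N (t + 1) x ≤ odometer d N t x + 1 := by
  by_cases h : Topples d N t x
  · exact (odometer_succ_of_topples h).le
  · rw [odometer_succ_of_not_topples h]; linarith

theorem odometer_le_succ (d N t : ℕ) (x : Fin d → ℤ) :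
    odometer d N t x ≤ odometer d N (t + 1) x := by
  by_cases h : Topples d N t x
  · rw [odometer_succ_of_topples h]; linarith
  · exact (odometer_succ_of_not_topples h).ge

theorem topples_of_lt {d N t : ℕ} {x : Fin d → ℤ}
    (h : odometer d N t x < odometer d N (t + 1) x) : Topples d N t x := by
  by_contra hn
  rw [odometer_succ_of_not_topples hn] at h
  exact lt_irrefl _ h

theorem odometer_nonneg (d N t : ℕ) (x : Fin d → ℤ) : 0 ≤ odometer d N t x := by
  induction t with
  | zero => exact le_rfl
  | succ t ih => exact ih.trans (odometer_le_succ d N t x)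

theorem odometer_le_time (d N t : ℕ) (x : Fin d → ℤ) : odometer d N t x ≤ t := by
  induction t with
  | zero => exact le_rfl
  | succ t ih => have := odometer_succ_le d N t x; push_cast; linarith

theorem odometer_eq_of_succ_eq {d N t : ℕ} {x : Fin d → ℤ}
    (h : odometer d N (t + 1) x = (t + 1 : ℕ)) : odometer d N t x = t := by
  have := odometer_succ_le d N t x
  have := odometer_le_time d N t x
  push_cast at h
  linarith

theorem mem_cube_of_odometer_pos {d N t : ℕ} {x : Fin d → ℤ} (h : 0 < odometer d N t x) :
    x ∈ cube d N := by
  by_contra hx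
  rw [odometer_eq_zero d N t x hx] at h
  exact lt_irrefl _ h

/-- Comparison of the toppling of two sites of possibly different sandpiles. -/
theorem topples_of_secondDiff_le {d N N' t t' : ℕ} {x x' : Fin d → ℤ} (h : Topples d N t x)
    (hx' : x' ∈ cube d N')
    (hle : ∀ i, secondDiff i (odometer d N t) x ≤ secondDiff i (odometer d N' t') x') :
    Topples d N' t' x' :=
  ⟨hx', h.2.trans (Finset.sum_le_sum fun i _ => hle i)⟩

/-- One step of a comparison argument. -/
theorem odometer_succ_le_add {d d' N N' t t' : ℕ} {x : Fin d → ℤ} {x' : Fin d' → ℤ} {c : ℤ}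
    (h : odometer d N t x ≤ odometer d' N' t' x' + c)
    (ht : odometer d N t x = odometer d' N' t' x' + c → Topples d N t x → Topples d' N' t' x') :
    odometer d N (t + 1) x ≤ odometer d' N' (t' + 1) x' + c := by
  have h1 := odometer_le_succ d' N' t' x'
  have h2 := odometer_succ_le d N t x
  rcases h.lt_or_eq with hlt | heq
  · linarith
  · by_cases hT : Topples d N t x
    · rw [odometer_succ_of_topples (ht heq hT)]; linarith
    · rw [odometer_succ_of_not_topples hT]; linarith

/-! ### Symmetries -/

theorem odometer_comp (d N t : ℕ) (φ : (Fin d → ℤ) → (Fin d → ℤ))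
    (hc : ∀ x, φ x ∈ cube d N ↔ x ∈ cube d N)
    (hs : ∀ (f : (Fin d → ℤ) → ℤ) x,
      ∑ i, secondDiff i (fun y => f (φ y)) x = ∑ i, secondDiff i f (φ x)) (x : Fin d → ℤ) :
    odometer d N t (φ x) = odometer d N t x := by
  induction t generalizing x with
  | zero => rfl
  | succ t ih =>
    have hT : Topples d N t (φ x) ↔ Topples d N t x := by
      rw [Topples, Topples, hc, ← hs]
      simp only [ih]
    by_cases h : Topples d N t x
    · rw [odometer_succ_of_topples h, odometer_succ_of_topples (hT.2 h), ih]
    · rw [odometer_succ_of_not_topples h, odometer_succ_of_not_topples (mt hT.1 h), ih]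

theorem odometer_perm (d N t : ℕ) (σ : Equiv.Perm (Fin d)) (x : Fin d → ℤ) :
    odometer d N t (fun i => x (σ i)) = odometer d N t x := by
  refine odometer_comp d N t (fun x i => x (σ i)) (fun x => ?_) (fun f x => ?_) x
  · exact ⟨fun h i => by simpa using h (σ.symm i), fun h i => h (σ i)⟩
  · refine (Equiv.sum_comp σ _).symm.trans (Finset.sum_congr rfl fun i _ => ?_)
    have h1 : (fun l => (x + Pi.single (σ i) 1 : Fin d → ℤ) (σ l))
        = (fun l => x (σ l)) + Pi.single i 1 := by
      funext l
      simp [Pi.single_apply]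
    have h2 : (fun l => (x - Pi.single (σ i) 1 : Fin d → ℤ) (σ l))
        = (fun l => x (σ l)) - Pi.single i 1 := by
      funext l
      simp [Pi.single_apply]
    simp only [secondDiff, h1, h2]

/-- The reflection of the `i`-th coordinate about the centre of the cube. -/
def reflect {d : ℕ} (N : ℕ) (i : Fin d) (x : Fin d → ℤ) : Fin d → ℤ :=
  Function.update x i ((((N + 1) / 2 : ℕ) : ℤ) + 1 - ((N / 2 : ℕ) : ℤ) - x i)

theorem odometer_reflect (d N t : ℕ) (i : Fin d) (x : Fin d → ℤ) :
    odometer d N t (reflect N i x) = odometer d N t x := by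
  refine odometer_comp d N t (reflect N i) (fun x => ?_) (fun f x => ?_) x
  · refine forall_congr' fun l => ?_
    by_cases hl : l = i
    · subst hl; simp only [reflect, Function.update_self]; omega
    · simp [reflect, hl]
  · refine Finset.sum_congr rfl fun l _ => ?_
    by_cases hl : l = i
    · subst hl
      have h1 : reflect N l (x + Pi.single l 1) = reflect N l x - Pi.single l 1 := by
        funext m
        by_cases hm : m = l
        · subst hm; simp [reflect]; ring
        · simp [reflect, hm]
      have h2 : reflect N l (x - Pi.single l 1) = reflect N l x + Pi.single l 1 := by
        funext m
        by_cases hm : m = l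
        · subst hm; simp [reflect]; ring
        · simp [reflect, hm]
      simp only [secondDiff, h1, h2]; ring
    · have h1 : reflect N i (x + Pi.single l 1) = reflect N i x + Pi.single l 1 := by
        funext m
        by_cases hm : m = i
        · subst hm; simp [reflect, Ne.symm hl]
        · simp [reflect, hm]
      have h2 : reflect N i (x - Pi.single l 1) = reflect N i x - Pi.single l 1 := by
        funext m
        by_cases hm : m = i
        · subst hm; simp [reflect, Ne.symm hl]
        · simp [reflect, hm]
      simp only [secondDiff, h1, h2]

theorem odometer_swap (d N t : ℕ) {i j : Fin d} {x y : Fin d → ℤ} (hi : x i = y j)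
    (hj : x j = y i) (hl : ∀ l, l ≠ i → l ≠ j → x l = y l) :
    odometer d N t x = odometer d N t y := by
  rw [← odometer_perm d N t (Equiv.swap i j) y]
  congr 1
  funext l
  by_cases h1 : l = i
  · subst h1; simpa using hi
  · by_cases h2 : l = j
    · subst h2; simpa using hj
    · rw [Equiv.swap_apply_of_ne_of_ne h1 h2]; exact hl l h1 h2

theorem odometer_center_even (d k t : ℕ) {i : Fin d} {x : Fin d → ℤ} (hx : x i = 1) :
    odometer d (2 * k) t (x - Pi.single i 1) = odometer d (2 * k) t x := by
  rw [← odometer_reflect d (2 * k) t i x]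
  congr 1
  funext l
  by_cases hl : l = i
  · subst hl; simp [reflect, hx]; omega
  · simp [reflect, hl]

/-- The cube is symmetric about `1/2` for even side and about `1` for odd side, which gives the two
alternatives. -/
theorem odometer_center (d N t : ℕ) {i : Fin d} {x : Fin d → ℤ} (hx : x i = 1) :
    odometer d N t (x - Pi.single i 1) = odometer d N t x ∨
      odometer d N t (x - Pi.single i 1) = odometer d N t (x + Pi.single i 1) := by
  rcases Nat.even_or_odd' N with ⟨k, rfl | rfl⟩
  · exact Or.inl (odometer_center_even d k t hx)
  · right
    rw [← odometer_reflect d (2 * k + 1) t i (x + Pi.single i 1)]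
    congr 1
    funext l
    by_cases hl : l = i
    · subst hl; simp [reflect, hx]; omega
    · simp [reflect, hl]

/-! ### Monotonicity, the parabolic bound and the initial wave -/

theorem odometer_add_single_le (d N t : ℕ) {i : Fin d} {x : Fin d → ℤ} (hx : 1 ≤ x i) :
    odometer d N t (x + Pi.single i 1) ≤ odometer d N t x := by
  induction t generalizing x with
  | zero => exact le_rfl
  | succ t ih =>
    have key := odometer_succ_le_add (c := 0) (x := x + Pi.single i 1) (x' := x) (N := N)
      (N' := N) (t := t) (t' := t) (by simpa using ih hx) fun heq hT => ?_
    · simpa using key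
    rw [add_zero] at heq
    refine topples_of_secondDiff_le hT (fun l => ?_) fun l => ?_
    · have := hT.1 l
      by_cases hl : l = i
      · subst hl; simp at this; omega
      · simpa [hl] using this
    · by_cases hl : l = i
      · subst hl
        have h1 := ih (x := x + Pi.single l 1) (by simp; omega)
        simp only [secondDiff, heq, add_sub_cancel_right]
        rcases hx.lt_or_eq with h | h
        · have h2 := ih (x := x - Pi.single l 1) (by simp; omega)
          rw [sub_add_cancel] at h2
          linarith
        · rcases odometer_center d N t h.symm with h2 | h2 <;> linarith
      · have h1 := ih (x := x + Pi.single l 1) (by simpa [Ne.symm hl] using hx)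
        have h2 := ih (x := x - Pi.single l 1) (by simpa [Ne.symm hl] using hx)
        rw [sub_add_eq_add_sub] at h2
        rw [add_right_comm] at h1
        simp only [secondDiff, heq]
        linarith

theorem odometer_center_le (d N t : ℕ) {i : Fin d} {x : Fin d → ℤ} (hx : x i = 1) :
    odometer d N t (x - Pi.single i 1) ≤ odometer d N t x := by
  rcases odometer_center d N t hx with h | h
  · exact h.le
  · exact h.le.trans (odometer_add_single_le d N t hx.ge)

/-- The right side is a parabola with second difference `-2`, nonnegative on the cube and its
neighbouring layers, so a site that attains it is stable. -/
theorem two_mul_odometer_le (d N t : ℕ) {i : Fin d} {x : Fin d → ℤ}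
    (hl : -((N / 2 : ℕ) : ℤ) ≤ x i) (hu : x i ≤ (((N + 1) / 2 : ℕ) : ℤ) + 1) :
    2 * odometer d N t x ≤
      (((N + 1) / 2 : ℕ) : ℤ) * ((((N + 1) / 2 : ℕ) : ℤ) + 1) - x i * (x i - 1) := by
  have hMb : ((N / 2 : ℕ) : ℤ) ≤ (((N + 1) / 2 : ℕ) : ℤ) := by omega
  have hb : (0 : ℤ) ≤ ((N / 2 : ℕ) : ℤ) := by positivity
  set M : ℤ := (((N + 1) / 2 : ℕ) : ℤ)
  set b : ℤ := ((N / 2 : ℕ) : ℤ)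
  induction t generalizing x with
  | zero => simp only [odometer]; nlinarith
  | succ t ih =>
    by_cases hT : Topples d N t x
    · rw [odometer_succ_of_topples hT]
      by_contra hcon
      have hxc : 1 - b ≤ x i ∧ x i ≤ M := hT.1 i
      -- Both products are even, so a bound broken by one toppling was attained exactly before it.
      have heq : 2 * odometer d N t x = M * (M + 1) - x i * (x i - 1) := by
        have h1 := ih hu hl
        obtain ⟨p, hp⟩ := Int.even_mul_succ_self M
        obtain ⟨q, hq⟩ := Int.even_mul_pred_self (x i)
        omega
      have hlt : 2 * ∑ l, secondDiff l (odometer d N t) x < 2 * ∑ _l : Fin d, 0 := by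
        rw [Finset.mul_sum, Finset.mul_sum]
        refine Finset.sum_lt_sum (fun l _ => ?_) ⟨i, Finset.mem_univ _, ?_⟩
        · by_cases hli : l = i
          · subst hli
            have h1 := ih (x := x + Pi.single l 1) (by simp; omega) (by simp; omega)
            have h2 := ih (x := x - Pi.single l 1) (by simp; omega) (by simp; omega)
            simp only [Pi.add_apply, Pi.sub_apply, Pi.single_eq_same] at h1 h2
            simp only [secondDiff]
            linarith
          · have h1 := ih (x := x + Pi.single l 1) (by simpa [Ne.symm hli] using hu)
              (by simpa [Ne.symm hli] using hl)
            have h2 := ih (x := x - Pi.single l 1) (by simpa [Ne.symm hli] using hu)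
              (by simpa [Ne.symm hli] using hl)
            simp only [Pi.add_apply, Pi.sub_apply, Pi.single_eq_of_ne (Ne.symm hli), add_zero,
              sub_zero] at h1 h2
            simp only [secondDiff]
            linarith
        · have h1 := ih (x := x + Pi.single i 1) (by simp; omega) (by simp; omega)
          have h2 := ih (x := x - Pi.single i 1) (by simp; omega) (by simp; omega)
          simp only [Pi.add_apply, Pi.sub_apply, Pi.single_eq_same] at h1 h2
          simp only [secondDiff]
          linarith
      have := hT.2
      simp only [Finset.sum_const_zero] at hlt
      linarith
    · rw [odometer_succ_of_not_topples hT]; exact ih hu hl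

/-- No site exceeds the value `t` at time `t`, so all second differences at `x` are nonpositive;
toppling forces each of them to vanish. -/
theorem odometer_neighbors_of_eq_time {d N t : ℕ} {x : Fin d → ℤ}
    (h : odometer d N (t + 1) x = (t + 1 : ℕ)) (i : Fin d) :
    odometer d N t (x + Pi.single i 1) = t ∧ odometer d N t (x - Pi.single i 1) = t := by
  have h0 := odometer_eq_of_succ_eq h
  have hT : Topples d N t x := topples_of_lt (by rw [h0, h]; push_cast; linarith)
  have hle : ∀ l, secondDiff l (odometer d N t) x ≤ 0 := fun l => by
    have := odometer_le_time d N t (x + Pi.single l 1)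
    have := odometer_le_time d N t (x - Pi.single l 1)
    simp only [secondDiff, h0]; linarith
  have hz := (Finset.sum_eq_zero_iff_of_nonpos fun l _ => hle l).1
    (le_antisymm (Finset.sum_nonpos fun l _ => hle l) hT.2) i (Finset.mem_univ i)
  have h1 := odometer_le_time d N t (x + Pi.single i 1)
  have h2 := odometer_le_time d N t (x - Pi.single i 1)
  simp only [secondDiff, h0] at hz
  constructor <;> linarith

theorem odometer_eq_time_of_sub {d N t : ℕ} {x : Fin d → ℤ} {i : Fin d}
    (h : odometer d N (t + 1) (x - Pi.single i 1) = (t + 1 : ℕ)) : odometer d N t x = t := by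
  simpa using (odometer_neighbors_of_eq_time h i).1

theorem odometer_eq_time_of_add {d N t : ℕ} {x : Fin d → ℤ} {i : Fin d}
    (h : odometer d N (t + 1) (x + Pi.single i 1) = (t + 1 : ℕ)) : odometer d N t x = t := by
  simpa using (odometer_neighbors_of_eq_time h i).2

/-- A site topples at two consecutive times only if it has toppled at all times before. -/
theorem odometer_eq_time_of_add_two {d N t : ℕ} {x : Fin d → ℤ}
    (h : odometer d N (t + 2) x = odometer d N t x + 2) :
    odometer d N (t + 2) x = (t + 2 : ℕ) := by
  induction t generalizing x with
  | zero => simpa [odometer] using h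
  | succ t ih =>
    have h1 := odometer_succ_le d N (t + 1) x
    have h2 := odometer_succ_le d N (t + 2) x
    have h3 := odometer_le_succ d N t x
    have hT2 : Topples d N (t + 2) x := topples_of_lt (by
      rw [show t + 1 + 2 = t + 2 + 1 from rfl] at h; linarith)
    have hT1 : Topples d N (t + 1) x := topples_of_lt (by
      rw [show t + 1 + 2 = t + 2 + 1 from rfl] at h; linarith)
    have e2 := odometer_succ_of_topples hT1
    have e3 := odometer_succ_of_topples hT2
    by_cases hT0 : Topples d N t x
    · have e1 := odometer_succ_of_topples hT0
      have := ih (x := x) (by rw [show t + 2 = t + 1 + 1 from rfl, e2, e1]; ring)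
      rw [show t + 1 + 2 = t + 2 + 1 from rfl, e3, this]
      push_cast; ring
    · have e1 := odometer_succ_of_not_topples hT0
      -- From time `t` to `t + 2` the site gains one. A neighbour gains at most one, since a
      -- neighbour gaining two is in the initial wave and would put `x` there too. So instability at
      -- `t + 2` implies instability at `t`.
      refine absurd ⟨hT2.1, hT2.2.trans (Finset.sum_le_sum fun i _ => ?_)⟩ hT0
      have hs : ∀ y, (odometer d N (t + 2) y = (t + 2 : ℕ) → odometer d N (t + 1) x = (t + 1 : ℕ))
          → odometer d N (t + 2) y ≤ odometer d N t y + 1 := by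
        intro y hy
        by_contra hcon
        have g1 := odometer_succ_le d N t y
        have g2 := odometer_succ_le d N (t + 1) y
        have g3 := hy (ih (le_antisymm (by linarith) (by linarith)))
        have := odometer_le_time d N t x
        push_cast at g3
        linarith
      have hp := hs (x + Pi.single i 1) odometer_eq_time_of_add
      have hm := hs (x - Pi.single i 1) odometer_eq_time_of_sub
      rw [show t + 1 + 1 = t + 2 from rfl] at e2
      simp only [secondDiff, e2, e1]
      linarith

/-- The odometer does not drop too fast from one site to the next, even with a delay. -/
theorem odometer_succ_le_add_single (d N t : ℕ) {i : Fin d} {x : Fin d → ℤ} (hx : 1 ≤ x i) :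
    odometer d N (t + 1) x ≤ odometer d N t (x + Pi.single i 1) + x i := by
  induction t generalizing x with
  | zero =>
    have := odometer_le_time d N 1 x
    simp only [odometer] at this ⊢
    push_cast at this; linarith
  | succ t ih =>
    by_cases hcube : x + Pi.single i 1 ∈ cube d N
    · refine odometer_succ_le_add (ih hx) fun heq hT => ?_
      -- Either `x` toppled twice in a row and the initial wave also moves its neighbour, or `x`
      -- rested at time `t` and the delay is invisible at `x`.
      by_cases hT0 : Topples d N t x
      · have h2 := odometer_eq_time_of_add_two (t := t) (x := x) (by
          rw [odometer_succ_of_topples hT, odometer_succ_of_topples hT0]; ring)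
        have h1 := (odometer_neighbors_of_eq_time (t := t + 1) h2 i).1
        exact topples_of_lt (by
          rw [h1, odometer_eq_of_succ_eq h1]; push_cast; linarith)
      · have e0 := odometer_succ_of_not_topples hT0
        refine topples_of_secondDiff_le hT hcube fun l => ?_
        by_cases hl : l = i
        · subst hl
          have h1 := ih (x := x + Pi.single l 1) (by simp; omega)
          simp only [Pi.add_apply, Pi.single_eq_same] at h1
          simp only [secondDiff, add_sub_cancel_right]
          rcases hx.lt_or_eq with h | h
          · have h2 := ih (x := x - Pi.single l 1) (by simp; omega)
            simp only [Pi.sub_apply, Pi.single_eq_same, sub_add_cancel] at h2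
            linarith
          · have h2 := odometer_center_le d N (t + 1) h.symm
            linarith
        · have h1 := ih (x := x + Pi.single l 1) (by simpa [Ne.symm hl] using hx)
          have h2 := ih (x := x - Pi.single l 1) (by simpa [Ne.symm hl] using hx)
          rw [sub_add_eq_add_sub] at h2
          rw [add_right_comm] at h1
          simp only [Pi.add_apply, Pi.sub_apply, Pi.single_eq_of_ne (Ne.symm hl), add_zero,
            sub_zero] at h1 h2
          simp only [secondDiff]
          linarith
    · rw [odometer_eq_zero d N _ _ hcube, zero_add]
      by_cases hxc : x ∈ cube d N
      · have hxi : x i = (((N + 1) / 2 : ℕ) : ℤ) := by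
          by_contra hne
          refine hcube fun l => ?_
          have := hxc l
          by_cases hl : l = i
          · subst hl; simp; omega
          · simpa [hl] using this
        -- At the face `x i = M` the parabolic bound reads `v ≤ M`.
        have := two_mul_odometer_le d N (t + 1 + 1) (i := i) (x := x) (by omega) (by omega)
        rw [← hxi] at this
        nlinarith
      · rw [odometer_eq_zero d N _ _ hxc]; linarith

/-! ### Dimensional reduction of the odometer -/

/-- The site obtained from `x` by inserting the coordinate `k` at the position `i`. -/
def ins {n : ℕ} (i : Fin (n + 1)) (k : ℤ) (x : Fin n → ℤ) : Fin (n + 1) → ℤ :=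
  Fin.insertNth (α := fun _ => ℤ) i k x

@[simp] theorem ins_self {n : ℕ} (i : Fin (n + 1)) (k : ℤ) (x : Fin n → ℤ) : ins i k x i = k := by
  simp [ins]

@[simp] theorem ins_succAbove {n : ℕ} (i : Fin (n + 1)) (k : ℤ) (x : Fin n → ℤ) (l : Fin n) :
    ins i k x (i.succAbove l) = x l := by
  simp [ins]

theorem eq_ins {n : ℕ} (i : Fin (n + 1)) (y : Fin (n + 1) → ℤ) :
    y = ins i (y i) fun l => y (i.succAbove l) := by
  funext m
  rcases Fin.eq_self_or_eq_succAbove i m with rfl | ⟨l, rfl⟩ <;> simp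

theorem ins_add_single_self {n : ℕ} (i : Fin (n + 1)) (k : ℤ) (x : Fin n → ℤ) :
    ins i k x + Pi.single i 1 = ins i (k + 1) x := by
  funext m
  rcases Fin.eq_self_or_eq_succAbove i m with rfl | ⟨l, rfl⟩ <;> simp [Fin.succAbove_ne]

theorem ins_sub_single_self {n : ℕ} (i : Fin (n + 1)) (k : ℤ) (x : Fin n → ℤ) :
    ins i k x - Pi.single i 1 = ins i (k - 1) x := by
  rw [sub_eq_iff_eq_add, ins_add_single_self, sub_add_cancel]

theorem ins_add_single_succAbove {n : ℕ} (i : Fin (n + 1)) (k : ℤ) (x : Fin n → ℤ) (l : Fin n) :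
    ins i k x + Pi.single (i.succAbove l) 1 = ins i k (x + Pi.single l 1) := by
  funext m
  rcases Fin.eq_self_or_eq_succAbove i m with rfl | ⟨l', rfl⟩
  · simp [(Fin.succAbove_ne m l).symm]
  · simp [Pi.single_apply]

theorem ins_sub_single_succAbove {n : ℕ} (i : Fin (n + 1)) (k : ℤ) (x : Fin n → ℤ) (l : Fin n) :
    ins i k x - Pi.single (i.succAbove l) 1 = ins i k (x - Pi.single l 1) := by
  rw [sub_eq_iff_eq_add, ins_add_single_succAbove, sub_add_cancel]

theorem ins_mem_cube {n N : ℕ} {i : Fin (n + 1)} {k : ℤ} {x : Fin n → ℤ}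
    (hk : 1 ≤ k ∧ k ≤ (((N + 1) / 2 : ℕ) : ℤ)) (hx : x ∈ cube n N) : ins i k x ∈ cube (n + 1) N := by
  intro m
  rcases Fin.eq_self_or_eq_succAbove i m with rfl | ⟨l, rfl⟩
  · rw [ins_self]; omega
  · rw [ins_succAbove]; exact hx l

theorem mem_cube_of_ins_mem {n N : ℕ} {i : Fin (n + 1)} {k : ℤ} {x : Fin n → ℤ}
    (h : ins i k x ∈ cube (n + 1) N) : x ∈ cube n N := fun l => by
  simpa using h (i.succAbove l)

theorem sum_secondDiff_ins {n : ℕ} (i : Fin (n + 1)) (k : ℤ) (x : Fin n → ℤ)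
    (g : (Fin (n + 1) → ℤ) → ℤ) :
    ∑ m, secondDiff m g (ins i k x) = (g (ins i (k + 1) x) + g (ins i (k - 1) x)
      - 2 * g (ins i k x)) + ∑ l, secondDiff l (fun y => g (ins i k y)) x := by
  rw [Fin.sum_univ_succAbove _ i]
  simp only [secondDiff, ins_add_single_self, ins_sub_single_self, ins_add_single_succAbove,
    ins_sub_single_succAbove]

/-- At equality both neighbours in the inserted direction lie under the value at the site, so that
direction only hinders toppling. -/
theorem odometer_ins_le (n N t : ℕ) (i : Fin (n + 1)) (k : ℤ) (x : Fin n → ℤ) :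
    odometer (n + 1) N t (ins i k x) ≤ odometer n N t x := by
  induction t generalizing k x with
  | zero => exact le_rfl
  | succ t ih =>
    have key := odometer_succ_le_add (c := 0) (by simpa using ih k x) fun heq hT =>
      (⟨mem_cube_of_ins_mem hT.1, ?_⟩ : Topples n N t x)
    · simpa using key
    have h1 := hT.2
    rw [sum_secondDiff_ins] at h1
    have h2 := ih (k + 1) x
    have h3 := ih (k - 1) x
    have h4 : ∑ l, secondDiff l (fun y => odometer (n + 1) N t (ins i k y)) x
        ≤ ∑ l, secondDiff l (odometer n N t) x := Finset.sum_le_sum fun l _ => by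
      have := ih k (x + Pi.single l 1)
      have := ih k (x - Pi.single l 1)
      simp only [secondDiff]
      linarith
    linarith

theorem odometer_ins_zero (n N t : ℕ) (i : Fin (n + 1)) (x : Fin n → ℤ) :
    odometer (n + 1) N t (ins i 0 x) = odometer (n + 1) N t (ins i 1 x) ∨
      odometer (n + 1) N t (ins i 0 x) = odometer (n + 1) N t (ins i 2 x) := by
  have h := odometer_center (n + 1) N t (i := i) (x := ins i 1 x) (by simp)
  rw [ins_add_single_self, ins_sub_single_self] at h
  exact h

theorem coord_of_odometer_eq_time {d N t : ℕ} {x : Fin d → ℤ}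
    (h : odometer d N (t + 1) x = (t + 1 : ℕ)) (i : Fin d) :
    x i ≤ (((N + 1) / 2 : ℕ) : ℤ) - t ∧ t + 1 - ((N / 2 : ℕ) : ℤ) ≤ x i := by
  induction t generalizing x with
  | zero =>
    have := mem_cube_of_odometer_pos (x := x) (by rw [h]; norm_num) i
    push_cast; omega
  | succ t ih =>
    obtain ⟨h1, h2⟩ := odometer_neighbors_of_eq_time h i
    have h3 := ih h1
    have h4 := ih h2
    simp only [Pi.add_apply, Pi.sub_apply, Pi.single_eq_same] at h3 h4
    push_cast at h3 h4 ⊢; omega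

/-- The initial wave spreads to the inserted direction at the cost of one time unit per layer. -/
theorem odometer_ins_eq_time {n N : ℕ} (hn : 1 ≤ n) (i : Fin (n + 1)) {t m : ℕ} {x : Fin n → ℤ}
    (h : odometer n N (t + m + 1) x = (t + m + 1 : ℕ)) :
    odometer (n + 1) N (t + 1) (ins i (m + 1) x) = (t + 1 : ℕ) := by
  have hcube : ∀ {s m : ℕ} {x : Fin n → ℤ}, odometer n N (s + m + 1) x = (s + m + 1 : ℕ) →
      ins i ((m : ℤ) + 1) x ∈ cube (n + 1) N := fun {s m x} h => by
    have h1 := coord_of_odometer_eq_time h ⟨0, hn⟩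
    push_cast at h1
    exact ins_mem_cube (by omega) (mem_cube_of_odometer_pos (by rw [h]; positivity))
  induction t generalizing m x with
  | zero =>
    rw [odometer_succ_of_topples ⟨hcube h, ?_⟩]
    · simp [odometer]
    · simp [secondDiff, odometer]
  | succ t ih =>
    have e : t + 1 + m + 1 = t + m + 1 + 1 := by ring
    rw [e] at h
    have h0 : odometer n N (t + m + 1) x = (t + m + 1 : ℕ) := odometer_eq_of_succ_eq h
    have v0 := ih h0
    have v1 : odometer (n + 1) N (t + 1) (ins i ((m : ℤ) + 1 + 1) x) = (t + 1 : ℕ) := by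
      have := ih (m := m + 1) (x := x) (by rw [← add_assoc]; exact h)
      push_cast at this ⊢; exact this
    have v2 : odometer (n + 1) N (t + 1) (ins i ((m : ℤ) + 1 - 1) x) = (t + 1 : ℕ) := by
      cases m with
      | zero =>
        simp only [Nat.cast_zero, zero_add, sub_self] at v0 v1 ⊢
        rcases odometer_ins_zero n N (t + 1) i x with g | g
        · rw [g, v0]
        · rw [g]; exact v1
      | succ m =>
        have := ih (m := m) (x := x) (odometer_eq_of_succ_eq h0)
        push_cast at this ⊢
        rw [add_sub_cancel_right]; exact this
    rw [odometer_succ_of_topples ⟨hcube (s := t + 1) (e ▸ h), ?_⟩, v0]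
    · push_cast; ring
    · rw [sum_secondDiff_ins, v0, v1, v2]
      have hz : ∑ l, secondDiff l (fun y => odometer (n + 1) N (t + 1) (ins i ((m : ℤ) + 1) y)) x
          = 0 := Finset.sum_eq_zero fun l _ => by
        obtain ⟨g1, g2⟩ := odometer_neighbors_of_eq_time h l
        simp only [secondDiff, v0, ih g1, ih g2]; ring
      rw [hz]; linarith

/-- The loss `c = m(m+1)/2` increases by `m + 1` from layer `m + 1` to the next, so the estimates of
the two adjacent layers balance. Only `m = 0` is used later, but the induction needs every layer. -/
theorem odometer_le_ins_add {n N : ℕ} (hn : 1 ≤ n) (i : Fin (n + 1)) (t m : ℕ)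
    (hm : m ≤ (N + 1) / 2) (c : ℤ) (hc : 2 * c = m * (m + 1)) (x : Fin n → ℤ) :
    odometer n N (t + m) x ≤ odometer (n + 1) N t (ins i (m + 1) x) + c := by
  induction t generalizing m c x with
  | zero =>
    have h1 := odometer_le_time n N (0 + m) x
    rw [zero_add] at h1 ⊢
    simp only [odometer]
    rcases Nat.eq_zero_or_pos m with h0 | h0
    · subst h0; push_cast at *; linarith
    · have : (1 : ℤ) ≤ m := by exact_mod_cast h0
      nlinarith
  | succ t ih =>
    by_cases hx : x ∈ cube n N
    swap
    · rw [odometer_eq_zero n N _ x hx]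
      have := odometer_nonneg (n + 1) N (t + 1) (ins i (m + 1) x)
      nlinarith [Int.natCast_nonneg m]
    -- For the largest `m` the layer `m + 1` is outside the cube, and the parabolic bound in
    -- dimension `n` gives the claim.
    rcases hm.lt_or_eq with hlt | heqm
    swap
    · have hx0 := hx ⟨0, hn⟩
      have h1 := two_mul_odometer_le n N (t + 1 + m) (i := ⟨0, hn⟩) (x := x) (by omega) (by omega)
      rw [← heqm] at h1
      have := odometer_nonneg (n + 1) N (t + 1) (ins i (m + 1) x)
      have h2 : 0 ≤ x ⟨0, hn⟩ * (x ⟨0, hn⟩ - 1) := by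
        rcases le_or_gt (x ⟨0, hn⟩) 0 with h | h
        · exact mul_nonneg_of_nonpos_of_nonpos h (by linarith)
        · exact mul_nonneg (by linarith) (by linarith [Int.add_one_le_iff.2 h])
      linarith
    rw [show t + 1 + m = t + m + 1 by ring]
    refine odometer_succ_le_add (ih m hm c hc x) fun heq hT => ?_
    have hcube : ins i ((m : ℤ) + 1) x ∈ cube (n + 1) N := ins_mem_cube (by omega) hx
    have hrest : ∑ l, secondDiff l (odometer n N (t + m)) x ≤
        ∑ l, secondDiff l (fun y => odometer (n + 1) N t (ins i ((m : ℤ) + 1) y)) x :=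
      Finset.sum_le_sum fun l _ => by
        have h1 := ih m hm c hc (x + Pi.single l 1)
        have h2 := ih m hm c hc (x - Pi.single l 1)
        simp only [secondDiff]
        linarith
    -- Since `x` topples at time `t + m`, the next layer lies at most `m` below layer `m + 1`.
    have hup := ih (m + 1) hlt (c + m + 1) (by push_cast; linarith) x
    rw [← add_assoc, odometer_succ_of_topples hT] at hup
    push_cast at hup
    have hT2 := hT.2
    cases m with
    | zero =>
      have hc0 : c = 0 := by push_cast at hc; linarith
      refine ⟨hcube, ?_⟩
      rw [sum_secondDiff_ins]
      simp only [Nat.cast_zero, zero_add, sub_self, hc0, add_zero, one_add_one_eq_two]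
        at hup heq hrest hT2 ⊢
      rcases odometer_ins_zero n N t i x with g | g <;> linarith
    | succ m =>
      -- The delay is now `m + 1`. If `x` also toppled one step earlier, the initial wave settles
      -- the claim. Otherwise the layer below is at least `m + 1` higher, which cancels the drop of
      -- at most `m + 1` above.
      by_cases hT0 : Topples n N (t + m) x
      · have h2 : odometer n N (t + m + 2) x = (t + m + 2 : ℕ) := odometer_eq_time_of_add_two (by
          have e1 := odometer_succ_of_topples hT
          rw [← add_assoc, odometer_succ_of_topples hT0] at e1
          rw [show t + m + 2 = t + m + 1 + 1 from rfl, e1]; ring)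
        have h1 := odometer_ins_eq_time hn i (t := t) (m := m + 1) (x := x) h2
        exact topples_of_lt (by rw [h1, odometer_eq_of_succ_eq h1]; push_cast; linarith)
      · have hdn := ih m (by omega) (c - (m + 1)) (by push_cast at hc; linarith) x
        have e1 := odometer_succ_of_not_topples hT0
        rw [add_assoc] at e1
        refine ⟨hcube, ?_⟩
        rw [sum_secondDiff_ins]
        push_cast at hup heq hrest hT2 hdn ⊢
        rw [add_sub_cancel_right]
        linarith

theorem odometer_ins_one {n N : ℕ} (hn : 1 ≤ n) (t : ℕ) (i : Fin (n + 1)) (x : Fin n → ℤ) :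
    odometer (n + 1) N t (ins i 1 x) = odometer n N t x := by
  refine le_antisymm (odometer_ins_le n N t i 1 x) ?_
  simpa using odometer_le_ins_add hn i t 0 (Nat.zero_le _) 0 (by simp) x

theorem topples_ins_one {n N : ℕ} (hn : 1 ≤ n) {t : ℕ} (i : Fin (n + 1)) {x : Fin n → ℤ}
    (h : Topples n N t x) : Topples (n + 1) N t (ins i 1 x) :=
  topples_of_lt (by
    rw [odometer_ins_one hn, odometer_ins_one hn, odometer_succ_of_topples h]; linarith)

/-- Coordinates that are equal to `1` can be disregarded. -/
theorem topples_of_sum_compl_nonneg {N t : ℕ} (n : ℕ) (K : Finset (Fin (n + 1)))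
    (hK : K ≠ Finset.univ) (z : Fin (n + 1) → ℤ) (hz : ∀ i ∈ K, z i = 1) (hc : z ∈ cube (n + 1) N)
    (h : 0 ≤ ∑ i ∈ Kᶜ, secondDiff i (odometer (n + 1) N t) z) : Topples (n + 1) N t z := by
  induction n with
  | zero =>
    rcases K.eq_empty_or_nonempty with rfl | hne
    · exact ⟨hc, by simpa using h⟩
    · obtain ⟨i, hi⟩ := hne
      refine absurd (Finset.eq_univ_of_forall fun l => ?_) hK
      rwa [show l = i from Fin.ext (by omega)]
  | succ n ih =>
    rcases K.eq_empty_or_nonempty with rfl | ⟨i, hi⟩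
    · exact ⟨hc, by simpa using h⟩
    obtain ⟨y, rfl⟩ : ∃ y, z = ins i 1 y :=
      ⟨_, (eq_ins i z).trans (by rw [hz i hi])⟩
    refine topples_ins_one (Nat.succ_pos n) i (ih (Finset.univ.filter fun l => i.succAbove l ∈ K)
      (fun hu => hK (Finset.eq_univ_of_forall fun l => ?_)) y (fun l hl => ?_)
      (mem_cube_of_ins_mem hc) ?_)
    · rcases Fin.eq_self_or_eq_succAbove i l with rfl | ⟨l', rfl⟩
      · exact hi
      · have := Finset.mem_univ l'
        rw [← hu] at this
        simpa using this
    · simpa using hz (i.succAbove l) (by simpa using hl)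
    · refine h.trans (le_of_eq ?_)
      have : Kᶜ = ((Finset.univ.filter fun l => i.succAbove l ∈ K)ᶜ).map i.succAboveEmb := by
        ext m
        rcases Fin.eq_self_or_eq_succAbove i m with rfl | ⟨l, rfl⟩ <;> simp [hi]
      rw [this, Finset.sum_map]
      refine Finset.sum_congr rfl fun l _ => ?_
      simp only [secondDiff, Fin.succAboveEmb_apply, ins_add_single_succAbove,
        ins_sub_single_succAbove, odometer_ins_one (Nat.succ_pos n)]

/-- Reduction to dimension one. -/
theorem odometer_update_one (N t n : ℕ) (i : Fin (n + 1)) (k : ℤ) :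
    odometer (n + 1) N t (Function.update (fun _ => 1) i k) = odometer 1 N t fun _ => k := by
  induction n with
  | zero =>
    congr 1
    funext l
    rw [show l = i from Fin.ext (by omega), Function.update_self]
  | succ n ih =>
    obtain ⟨j, hj⟩ := exists_ne i
    obtain ⟨i', rfl⟩ := Fin.exists_succAbove_eq hj.symm
    rw [← ih i', ← odometer_ins_one (Nat.succ_pos n) t j]
    congr 1
    funext m
    rcases Fin.eq_self_or_eq_succAbove j m with rfl | ⟨l, rfl⟩
    · rw [ins_self, Function.update_of_ne hj]
    · simp [Function.update_apply]

/-! ### The terminal sandpile -/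

/-- Below the largest coordinate the odometer is flatter, up to a delay. -/
theorem odometer_le_succ_add_single {d N t : ℕ} {i : Fin d} {x : Fin d → ℤ} (hx : 1 ≤ x i)
    (hj : ∃ j, x i + 1 ≤ x j) :
    odometer d N t x ≤ odometer d N (t + 1) (x + Pi.single i 1) + (x i - 1) := by
  induction t generalizing x with
  | zero =>
    have := odometer_nonneg d N 1 (x + Pi.single i 1)
    simp only [odometer] at this ⊢
    linarith
  | succ t ih =>
    refine odometer_succ_le_add (ih hx hj) fun heq hT => ?_
    have hji : ∀ {j}, x i + 1 ≤ x j → j ≠ i := fun h he => by subst he; linarith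
    have ihl : ∀ l, l ≠ i → (∃ j, j ≠ l ∧ x i + 1 ≤ x j) ∨ x i + 2 ≤ x l → secondDiff l
        (odometer d N t) x ≤ secondDiff l (odometer d N (t + 1)) (x + Pi.single i 1) := by
      intro l hl hlj
      have h1 := ih (x := x + Pi.single l 1) (by simpa [hl.symm] using hx) (by
        rcases hlj with ⟨j, hjl, hj⟩ | h
        · exact ⟨j, by simpa [hl.symm, hjl] using hj⟩
        · exact ⟨l, by simp [hl.symm]; linarith⟩)
      have h2 := ih (x := x - Pi.single l 1) (by simpa [hl.symm] using hx) (by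
        rcases hlj with ⟨j, hjl, hj⟩ | h
        · exact ⟨j, by simpa [hl.symm, hjl] using hj⟩
        · exact ⟨l, by simp [hl.symm]; linarith⟩)
      rw [add_right_comm] at h1
      rw [sub_add_eq_add_sub] at h2
      simp only [Pi.add_apply, Pi.sub_apply, Pi.single_eq_of_ne hl.symm, add_zero,
        sub_zero] at h1 h2
      simp only [secondDiff]
      linarith
    have hxs := odometer_succ_of_topples hT
    -- At the wall `x i = 1` the required `-1` comes from the toppling of `x` at time `t`.
    have hdown : odometer d N t (x - Pi.single i 1) ≤ odometer d N (t + 1) x + (x i - 2) := by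
      rcases hx.lt_or_eq with h | h
      · obtain ⟨j, hj⟩ := hj
        have := ih (x := x - Pi.single i 1) (by simp; omega)
          ⟨j, by simp [hji hj]; linarith⟩
        simp only [Pi.sub_apply, Pi.single_eq_same, sub_add_cancel] at this
        linarith
      · have := odometer_center_le d N t h.symm
        linarith
    refine topples_of_secondDiff_le hT (fun l => ?_) fun l => ?_
    · have := hT.1 l
      obtain ⟨j, hj⟩ := hj
      have := hT.1 j
      by_cases hl : l = i
      · subst hl; simp; omega
      · simpa [hl] using hT.1 l
    by_cases hbig : ∃ j, x i + 2 ≤ x j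
    · obtain ⟨j, hjb⟩ := hbig
      by_cases hl : l = i
      · subst hl
        have h1 := ih (x := x + Pi.single l 1) (by simp; omega)
          ⟨j, by simp [hji (show x l + 1 ≤ x j by linarith)]; linarith⟩
        simp only [Pi.add_apply, Pi.single_eq_same] at h1
        simp only [secondDiff, add_sub_cancel_right]
        linarith
      · refine ihl l hl ?_
        by_cases hlj : l = j
        · subst hlj; exact Or.inr hjb
        · exact Or.inl ⟨j, Ne.symm hlj, by linarith⟩
    · push Not at hbig
      -- When the largest coordinate is `x i + 1`, the induction hypothesis no longer reaches `x +
      -- e_i`. Exchanging coordinates `i` and `j` replaces the unreachable neighbours by `x + 2e_i`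
      -- and `x`.
      have hswap : ∀ j, x j = x i + 1 →
          (odometer d N (t + 1) (x + Pi.single i 1 + Pi.single j 1) =
            odometer d N (t + 1) (x + Pi.single i 1 + Pi.single i 1)) ∧
          odometer d N (t + 1) (x + Pi.single i 1 - Pi.single j 1) = odometer d N (t + 1) x := by
        intro j hj
        have hne := hji hj.ge
        constructor
        · refine odometer_swap d N _ (i := i) (j := j) ?_ ?_ fun m h1 h2 => ?_
          · simp [hne, hne.symm]; omega
          · simp [hne]; omega
          · simp [h1, h2]
        · refine odometer_swap d N _ (i := i) (j := j) ?_ ?_ fun m h1 h2 => ?_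
          · simp [hne.symm]; omega
          · simp [hne]; omega
          · simp [h1, h2]
      have hsrc : ∀ j, x j = x i + 1 → odometer d N t (x + Pi.single j 1) ≤
          odometer d N (t + 1) (x + Pi.single i 1 + Pi.single i 1) + (x i - 1) := by
        intro j hj
        have hne := hji hj.ge
        have h := ih (x := x + Pi.single j 1) (by simpa [hne.symm] using hx)
          ⟨j, by simp [hne.symm]; linarith⟩
        rw [add_right_comm, (hswap j hj).1] at h
        simpa [hne.symm] using h
      -- The path from `x` through `x + e_j` to the mirror image of `x + 2e_i` loses `(x i + 1) + (x
      -- i - 1)`.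
      have hlow : ∀ j, x j = x i + 1 → odometer d N (t + 1) x ≤
          odometer d N (t + 1) (x + Pi.single i 1 + Pi.single i 1) + 2 * x i := by
        intro j hj
        have h1 := odometer_succ_le_add_single d N t (i := j) (x := x) (by linarith)
        have h2 := hsrc j hj
        linarith
      by_cases hl : l = i
      · subst hl
        obtain ⟨j, hj⟩ := hj
        have h1 := hlow j (by have := hbig j; omega)
        have h2 := odometer_le_succ d N t (x + Pi.single l 1)
        simp only [secondDiff, add_sub_cancel_right]
        linarith
      · by_cases hxl : x l = x i + 1
        · have h1 := hsrc l hxl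
          have h2 := odometer_succ_le_add_single d N t (i := l) (x := x - Pi.single l 1)
            (by simp; omega)
          have h3 := odometer_le_succ d N t (x - Pi.single l 1)
          rw [sub_add_cancel] at h2
          simp only [Pi.sub_apply, Pi.single_eq_same] at h2
          simp only [secondDiff, hswap l hxl]
          linarith
        · refine ihl l hl (Or.inl ?_)
          obtain ⟨j, hj⟩ := hj
          exact ⟨j, fun h => hxl (by subst h; have := hbig j; omega), hj⟩

theorem odometer_eq_of_stable {d N t : ℕ} (ht : t ∈ stableTimes d N) {x : Fin d → ℤ} :
    odometer d N (t + 1) x = odometer d N t x := by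
  refine odometer_succ_of_not_topples fun hT => ?_
  have h1 := ht x hT.1
  rw [sandpile_eq d N t x hT.1, laplacian_eq_sum] at h1
  linarith [hT.2]

theorem mem_stableTimes {d N t : ℕ} (hd : 1 ≤ d) (ht : sInf (stableTimes d N) ≤ t) :
    t ∈ stableTimes d N := fun x hx => by
  rw [sandpile_eq_terminal d N t hd ht]
  exact Nat.sInf_mem (stableTimes_nonempty d N hd) x hx

/-- After stabilization the delay disappears, so layers `1` and `2` coincide here. Whichever way
layer `0` is reflected, the second difference in direction `i` is zero. -/
theorem terminalSandpile_ins_one {n N : ℕ} (hn : 1 ≤ n) (i : Fin (n + 1)) {x : Fin n → ℤ}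
    (hx : x ∈ cube n N) (h2 : ∃ j, 2 ≤ x j) :
    terminalSandpile (n + 1) N (ins i 1 x) = terminalSandpile n N x + 2 := by
  obtain ⟨j, hj⟩ := h2
  have hM := hx j
  have hcube : ins i 1 x ∈ cube (n + 1) N := ins_mem_cube (by omega) hx
  set T := max (sInf (stableTimes (n + 1) N)) (sInf (stableTimes n N))
  rw [← sandpile_eq_terminal (n + 1) N T (Nat.succ_pos n) (le_max_left _ _),
    ← sandpile_eq_terminal n N T hn (le_max_right _ _), sandpile_eq _ _ _ _ hcube,
    sandpile_eq _ _ _ _ hx, laplacian_eq_sum, laplacian_eq_sum, sum_secondDiff_ins]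
  have hst := mem_stableTimes (Nat.succ_pos n) (le_max_left _ _ : _ ≤ T)
  have hge := odometer_le_succ_add_single (d := n + 1) (N := N) (t := T) (i := i)
    (x := ins i 1 x) (by simp) ⟨i.succAbove j, by simp; linarith⟩
  have hle := odometer_ins_le n N T i 2 x
  rw [ins_add_single_self, odometer_eq_of_stable hst, ins_self, sub_self, add_zero,
    odometer_ins_one hn, one_add_one_eq_two] at hge
  have h0 := odometer_ins_zero n N T i x
  rw [odometer_ins_one hn] at h0
  simp only [one_add_one_eq_two, sub_self, odometer_ins_one hn]
  push_cast
  rcases h0 with h0 | h0 <;> linarith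

/-! ### Self-similarity in dimension one -/

/-- The one-dimensional odometer as a function on `ℤ`. -/
noncomputable def line (N t : ℕ) (c : ℤ) : ℤ :=
  odometer 1 N t fun _ => c

theorem const_add_single (c : ℤ) :
    (fun _ : Fin 1 => c) + Pi.single 0 1 = fun _ => c + 1 := by
  funext i
  rw [show i = 0 from Fin.ext (by omega)]
  simp

theorem const_sub_single (c : ℤ) :
    (fun _ : Fin 1 => c) - Pi.single 0 1 = fun _ => c - 1 := by
  funext i
  rw [show i = 0 from Fin.ext (by omega)]
  simp

theorem topples_const {N t : ℕ} {c : ℤ} :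
    Topples 1 N t (fun _ => c) ↔
      (1 - ((N / 2 : ℕ) : ℤ) ≤ c ∧ c ≤ (((N + 1) / 2 : ℕ) : ℤ)) ∧
        2 * line N t c ≤ line N t (c + 1) + line N t (c - 1) := by
  simp only [Topples, secondDiff, Fin.sum_univ_one, const_add_single, const_sub_single, line, cube,
    Set.mem_ofPred_eq, forall_const, sub_nonneg]

theorem line_succ_le_add {N N' t t' : ℕ} {c c' k : ℤ} (h : line N t c ≤ line N' t' c' + k)
    (hc : 1 ≤ c' ∧ c' ≤ (((N' + 1) / 2 : ℕ) : ℤ))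
    (ht : line N t c = line N' t' c' + k → line N (t + 1) c = line N t c + 1 →
      2 * line N t c ≤ line N t (c + 1) + line N t (c - 1) →
      2 * line N' t' c' ≤ line N' t' (c' + 1) + line N' t' (c' - 1)) :
    line N (t + 1) c ≤ line N' (t' + 1) c' + k :=
  odometer_succ_le_add h fun heq hT =>
    topples_const.2 ⟨by omega, ht heq (odometer_succ_of_topples hT) (topples_const.1 hT).2⟩

theorem line_zero (N : ℕ) (c : ℤ) : line N 0 c = 0 := rfl

theorem line_nonneg (N t : ℕ) (c : ℤ) : 0 ≤ line N t c := odometer_nonneg _ _ _ _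

theorem line_succ_le (N t : ℕ) (c : ℤ) : line N (t + 1) c ≤ line N t c + 1 :=
  odometer_succ_le _ _ _ _

theorem line_eq_zero {N t : ℕ} {c : ℤ} (h : (((N + 1) / 2 : ℕ) : ℤ) < c) : line N t c = 0 :=
  odometer_eq_zero 1 N t _ fun hc => absurd (hc 0).2 (not_le.2 h)

theorem line_add_one_le (N t : ℕ) {c : ℤ} (hc : 1 ≤ c) : line N t (c + 1) ≤ line N t c := by
  have := odometer_add_single_le 1 N t (i := 0) (x := fun _ => c) hc
  rwa [const_add_single] at this

theorem line_center_le (N t : ℕ) : line N t 0 ≤ line N t 1 := by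
  have := odometer_center_le 1 N t (i := 0) (x := fun _ => 1) rfl
  rwa [const_sub_single, sub_self] at this

theorem line_center_even (k t : ℕ) : line (2 * k) t 0 = line (2 * k) t 1 := by
  have := odometer_center_even 1 k t (i := 0) (x := fun _ => 1) rfl
  rwa [const_sub_single, sub_self] at this

theorem line_succ_le_add_one (N t : ℕ) {c : ℤ} (hc : 1 ≤ c) :
    line N (t + 1) c ≤ line N t (c + 1) + c := by
  have := odometer_succ_le_add_single 1 N t (i := 0) (x := fun _ => c) hc
  rwa [const_add_single] at this

/-- Before the boundary has toppled `j` times, the odometer is flatter, up to a delay. -/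
theorem line_le_succ_add {j T : ℕ} (hT : ∀ s < T, line (2 * j) s j ≤ j - 1) {t : ℕ} (ht : t < T)
    {c : ℤ} (hc : 1 ≤ c) : line (2 * j) t c ≤ line (2 * j) (t + 1) (c + 1) + (c - 1) := by
  induction t generalizing c with
  | zero =>
    have := line_nonneg (2 * j) 1 (c + 1)
    rw [line_zero]; linarith
  | succ t ih =>
    rcases lt_trichotomy c j with h | h | h
    · refine line_succ_le_add (ih (by omega) hc) (by omega) fun heq hs h2 => ?_
      have h3 := ih (by omega) (c := c + 1) (by omega)
      rw [add_sub_cancel_right]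
      rcases hc.lt_or_eq with h4 | h4
      · have h5 := ih (by omega) (c := c - 1) (by omega)
        rw [sub_add_cancel] at h5
        linarith
      · subst h4
        have h5 := line_center_le (2 * j) t
        rw [sub_self] at h2
        linarith
    -- The boundary site is the only place where the restriction `t < T` is needed.
    · subst h
      have := hT _ ht
      have := line_nonneg (2 * j) (t + 1 + 1) (j + 1)
      linarith
    · rw [line_eq_zero (by omega)]
      have := line_nonneg (2 * j) (t + 1 + 1) (c + 1)
      linarith

/-- The equality beyond `a` is proved together with two flatness bounds on `1, …, a`. The bounds
link times `s` and `s + 1`, so the invariant at `t` also records the previous step, which every part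
of the induction uses. -/
theorem line_selfSimilar {N j T : ℕ} {a : ℤ} (ha : 1 ≤ a) (hj : 1 ≤ j)
    (hM : (((N + 1) / 2 : ℕ) : ℤ) = a + j) (hT : ∀ s < T, line (2 * j) s j ≤ j - 1) (t : ℕ)
    (ht : t ≤ T) :
    (∀ y, 1 ≤ y → line N t (y + a) = line (2 * j) t y) ∧
      ∀ s, s + 1 = t → (∀ y, 1 ≤ y → line N s (y + a) = line (2 * j) s y) ∧
        ∀ x, 1 ≤ x → x ≤ a → line N s x ≤ line N (s + 1) (x + 1) ∧
          line N (s + 1) x ≤ line N s (x + 1) + 1 := by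
  induction t with
  | zero => exact ⟨fun _ _ => rfl, fun s hs => absurd hs (Nat.succ_ne_zero s)⟩
  | succ t ih =>
    obtain ⟨hE, hprev⟩ := ih (by omega)
    refine ⟨fun y hy => ?_, fun s hs => ?_⟩
    · have hyj : (((2 * j + 1) / 2 : ℕ) : ℤ) = j := by omega
      rcases lt_or_ge (j : ℤ) y with h | h
      · rw [line_eq_zero (by omega), line_eq_zero (by omega)]
      have hiff : 2 * line N t (y + a) ≤ line N t (y + a + 1) + line N t (y + a - 1) ↔
          2 * line (2 * j) t y ≤ line (2 * j) t (y + 1) + line (2 * j) t (y - 1) := by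
        have h1 := hE (y + 1) (by omega)
        rw [add_right_comm] at h1
        rw [h1, hE y hy]
        rcases hy.lt_or_eq with h2 | rfl
        · have h3 := hE (y - 1) (by omega)
          rw [sub_add_eq_add_sub] at h3
          rw [h3]
        · have e1 := hE 1 le_rfl
          rw [add_sub_cancel_left, sub_self, line_center_even]
          rw [add_comm 1 a] at e1 h1
          constructor
          -- If `a + 1` toppled alone, site `a` would be one above it and site `a + 2` one below it.
          -- The delayed bounds, passing through `a + 1` one step earlier, put `a` at most one above
          -- `a + 2`.
          · intro hu
            by_contra hw
            obtain _ | s := t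
            · simp only [line_zero] at hw; omega
            obtain ⟨hEs, hSs⟩ := hprev s rfl
            obtain ⟨g1, g2⟩ := hSs a ha le_rfl
            have g3 := line_succ_le N s a
            have g4 := line_le_succ_add hT (t := s) (by omega) (c := 1) le_rfl
            have g5 := hEs 1 le_rfl
            rw [add_comm 1 a] at g5
            linarith
          · intro hw
            have := line_add_one_le N t ha
            linarith
      apply le_antisymm
      · have key := line_succ_le_add (N := N) (t := t) (c := y + a) (N' := 2 * j) (t' := t)
          (c' := y) (k := 0) (by rw [hE y hy]; simp) (by omega) fun _ _ h2 => hiff.1 h2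
        simpa using key
      · have key := line_succ_le_add (N := 2 * j) (t := t) (c := y) (N' := N) (t' := t)
          (c' := y + a) (k := 0) (by rw [hE y hy]; simp) (by omega) fun _ _ h2 => hiff.2 h2
        simpa using key
    · obtain rfl : s = t := by omega
      refine ⟨hE, fun x hx hxa => ?_⟩
      obtain _ | r := s
      · have h1 := line_succ_le N 0 x
        have h2 := line_nonneg N (0 + 1) (x + 1)
        simp only [line_zero] at h1 h2 ⊢
        exact ⟨h2, h1⟩
      obtain ⟨hEr, hSr⟩ := hprev r rfl
      obtain ⟨hS, hA⟩ := hSr x hx hxa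
      have e1 := hE 2 (by norm_num)
      have e2 := hE 1 le_rfl
      have e3 := hEr 1 le_rfl
      have e4 := hEr 2 (by norm_num)
      constructor
      · have key := line_succ_le_add (N := N) (t := r) (c := x) (N' := N) (t' := r + 1)
          (c' := x + 1) (k := 0) (by simpa using hS) (by omega) fun heq hs h2 => ?_
        · simpa using key
        have g1 : line N r (x + 1) ≤ line N (r + 1) (x + 1 + 1) := by
          rcases hxa.lt_or_eq with h | rfl
          · exact (hSr (x + 1) (by omega) (by omega)).1
          · have := line_le_succ_add hT (t := r) (by omega) (c := 1) le_rfl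
            rw [one_add_one_eq_two, ← e3, ← e1] at this
            rw [add_comm x 1, add_right_comm, one_add_one_eq_two]
            linarith
        rw [add_sub_cancel_right]
        linarith
      · refine line_succ_le_add hA (by omega) fun heq hs h2 => ?_
        have g1 : line N (r + 1) (x + 1) ≤ line N r (x + 1 + 1) + 1 := by
          rcases hxa.lt_or_eq with h | rfl
          · exact (hSr (x + 1) (by omega) (by omega)).2
          · have := line_succ_le_add_one (2 * j) r (c := 1) le_rfl
            rw [one_add_one_eq_two, ← e2, ← e4] at this
            rw [add_comm x 1, add_right_comm, one_add_one_eq_two]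
            linarith
        have g2 : line N (r + 1) (x - 1) ≤ line N r x + 1 := by
          rcases hx.lt_or_eq with h | rfl
          · have := (hSr (x - 1) (by omega) (by omega)).2
            rwa [sub_add_cancel] at this
          · rw [sub_self]
            exact (line_center_le N (r + 1)).trans (line_succ_le N r 1)
        rw [add_sub_cancel_right]
        linarith

/-! ### Self-similarity in every dimension -/

theorem odometer_antitone {d N t : ℕ} {x y : Fin d → ℤ} (hx : ∀ i, 1 ≤ x i)
    (hxy : ∀ i, x i ≤ y i) : odometer d N t y ≤ odometer d N t x := by
  obtain ⟨k, hk⟩ : ∃ k : ℕ, (k : ℤ) = ∑ i, (y i - x i) :=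
    ⟨_, Int.toNat_of_nonneg (Finset.sum_nonneg fun i _ => sub_nonneg.2 (hxy i))⟩
  induction k generalizing y with
  | zero =>
    have h := (Finset.sum_eq_zero_iff_of_nonneg fun i _ => sub_nonneg.2 (hxy i)).1
      (by rw [← hk]; rfl)
    rw [show y = x from funext fun i => sub_eq_zero.1 (h i (Finset.mem_univ i))]
  | succ k ih =>
    obtain ⟨i, -, hi⟩ := Finset.exists_lt_of_sum_lt (s := Finset.univ) (f := fun _ : Fin d => (0 : ℤ))
      (g := fun i => y i - x i) (by rw [← hk, Finset.sum_const_zero]; positivity)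
    have h1 := odometer_add_single_le d N t (i := i) (x := y - Pi.single i 1) (by
      have := hx i; simp; omega)
    rw [sub_add_cancel] at h1
    refine h1.trans (ih (fun l => ?_) ?_)
    · by_cases hl : l = i
      · subst hl; simp; omega
      · simpa [hl] using hxy l
    · have : ∀ l, (y - Pi.single i 1 : Fin d → ℤ) l - x l
          = (y l - x l) - (Pi.single i 1 : Fin d → ℤ) l := fun l => by simp; ring
      simp only [this, Finset.sum_sub_distrib, Finset.sum_pi_single', Finset.mem_univ, if_true]
      rw [Finset.sum_sub_distrib] at hk
      push_cast at hk
      linarith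

/-- The site of the smaller cube that corresponds to `x`. -/
def clamp {d : ℕ} (a : ℤ) (x : Fin d → ℤ) : Fin d → ℤ := fun i => max (x i - a) 1

theorem clamp_add_single {d : ℕ} {a : ℤ} {x : Fin d → ℤ} {i : Fin d} (h : a + 1 ≤ x i) :
    clamp a (x + Pi.single i 1) = clamp a x + Pi.single i 1 := by
  funext l
  by_cases hl : l = i
  · subst hl; simp only [clamp, Pi.add_apply, Pi.single_eq_same]; omega
  · simp [clamp, hl]

theorem clamp_sub_single {d : ℕ} {a : ℤ} {x : Fin d → ℤ} {i : Fin d} (h : a + 2 ≤ x i) :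
    clamp a (x - Pi.single i 1) = clamp a x - Pi.single i 1 := by
  funext l
  by_cases hl : l = i
  · subst hl; simp only [clamp, Pi.sub_apply, Pi.single_eq_same]; omega
  · simp [clamp, hl]

theorem clamp_add_single_of_le {d : ℕ} {a : ℤ} {x : Fin d → ℤ} {i : Fin d} (h : x i ≤ a) :
    clamp a (x + Pi.single i 1) = clamp a x := by
  funext l
  by_cases hl : l = i
  · subst hl; simp only [clamp, Pi.add_apply, Pi.single_eq_same]; omega
  · simp [clamp, hl]

theorem clamp_sub_single_of_le {d : ℕ} {a : ℤ} {x : Fin d → ℤ} {i : Fin d} (h : x i ≤ a + 1) :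
    clamp a (x - Pi.single i 1) = clamp a x := by
  funext l
  by_cases hl : l = i
  · subst hl; simp only [clamp, Pi.sub_apply, Pi.single_eq_same]; omega
  · simp [clamp, hl]

/-- Coordinates at most `a` give zero second differences in the large cube and may be discarded in
the small one, where they are clamped to `1`. The other directions match, by reflection when a
coordinate is `a + 1`. The hypothesis `hne` keeps the inner neighbour within reach of `ih`. -/
theorem topples_clamp_iff {n N j t : ℕ} {a : ℤ} (ha : 1 ≤ a)
    (hM : (((N + 1) / 2 : ℕ) : ℤ) = a + j)
    (ih : ∀ x : Fin (n + 1) → ℤ, (∀ i, 1 ≤ x i) → (∃ i, a + 1 ≤ x i) →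
      odometer (n + 1) N t x = odometer (n + 1) (2 * j) t (clamp a x))
    {x : Fin (n + 1) → ℤ} (hx : ∀ i, 1 ≤ x i) (hmax : ∃ i, a + 1 ≤ x i)
    (hne : ∀ i, x i = a + 1 → ∃ l, l ≠ i ∧ a + 1 ≤ x l) :
    Topples (n + 1) N t x ↔ Topples (n + 1) (2 * j) t (clamp a x) := by
  classical
  have hcube : x ∈ cube (n + 1) N ↔ clamp a x ∈ cube (n + 1) (2 * j) := by
    obtain ⟨i, hi⟩ := hmax
    constructor
    · intro h l
      have := h l
      have := h i
      simp only [clamp]; omega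
    · intro h l
      have := h l
      have := hx l
      simp only [clamp] at *; omega
  set K : Finset (Fin (n + 1)) := Finset.univ.filter fun i => x i ≤ a with hKdef
  have hK : K ≠ Finset.univ := fun hu => by
    obtain ⟨i, hi⟩ := hmax
    have := Finset.mem_univ i
    rw [← hu, hKdef, Finset.mem_filter] at this
    linarith [this.2]
  have hx0 := ih x hx hmax
  have hup : ∀ i, odometer (n + 1) N t (x + Pi.single i 1) =
      odometer (n + 1) (2 * j) t (clamp a (x + Pi.single i 1)) := fun i => by
    refine ih _ (fun l => ?_) ?_
    · have := hx l
      by_cases hl : l = i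
      · subst hl; simp; omega
      · simpa [hl] using this
    · obtain ⟨l, hl⟩ := hmax
      refine ⟨l, ?_⟩
      by_cases hli : l = i
      · subst hli; simp; omega
      · simpa [hli] using hl
  have hdn : ∀ i, 2 ≤ x i → (∃ l, a + 1 ≤ (x - Pi.single i 1 : Fin (n + 1) → ℤ) l) →
      odometer (n + 1) N t (x - Pi.single i 1) =
      odometer (n + 1) (2 * j) t (clamp a (x - Pi.single i 1)) := fun i h2 h => by
    refine ih _ (fun l => ?_) h
    have := hx l
    by_cases hl : l = i
    · subst hl; simp; omega
    · simpa [hl] using this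
  have hin : ∀ i ∈ K, secondDiff i (odometer (n + 1) N t) x = 0 := by
    intro i hi
    have hia : x i ≤ a := (Finset.mem_filter.1 hi).2
    have h1 := hup i
    rw [clamp_add_single_of_le hia, ← hx0] at h1
    have h2 : odometer (n + 1) N t (x - Pi.single i 1) = odometer (n + 1) N t x := by
      rcases (hx i).lt_or_eq with h | h
      · obtain ⟨l, hl⟩ := hmax
        have hli : l ≠ i := fun e => by subst e; linarith
        have h3 := hdn i h ⟨l, by simpa [hli] using hl⟩
        rwa [clamp_sub_single_of_le (by linarith), ← hx0] at h3
      · rcases odometer_center (n + 1) N t h.symm with g | g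
        · exact g
        · rw [g, h1]
    simp only [secondDiff, h1, h2]; ring
  have hout : ∀ i ∈ Kᶜ, secondDiff i (odometer (n + 1) N t) x =
      secondDiff i (odometer (n + 1) (2 * j) t) (clamp a x) := by
    intro i hi
    have hia : a + 1 ≤ x i := by
      by_contra h
      exact Finset.mem_compl.1 hi (Finset.mem_filter.2 ⟨Finset.mem_univ i, by linarith⟩)
    have h1 := hup i
    rw [clamp_add_single hia] at h1
    have h2 : odometer (n + 1) N t (x - Pi.single i 1) =
        odometer (n + 1) (2 * j) t (clamp a x - Pi.single i 1) := by
      rcases hia.lt_or_eq with h | h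
      · rw [hdn i (by linarith) ⟨i, by simp; omega⟩, clamp_sub_single (by omega)]
      · obtain ⟨l, hli, hl⟩ := hne i h.symm
        rw [hdn i (by linarith) ⟨l, by simpa [hli] using hl⟩, clamp_sub_single_of_le h.ge,
          odometer_center_even (n + 1) j t (by simp only [clamp]; omega)]
    simp only [secondDiff, h1, h2, hx0]
  have hsum : ∑ i, secondDiff i (odometer (n + 1) N t) x =
      ∑ i ∈ Kᶜ, secondDiff i (odometer (n + 1) (2 * j) t) (clamp a x) := by
    rw [← Finset.sum_add_sum_compl K, Finset.sum_eq_zero hin, zero_add, Finset.sum_congr rfl hout]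
  have hone : ∀ i ∈ K, clamp a x i = 1 := fun i hi => by
    have : x i ≤ a := (Finset.mem_filter.1 hi).2
    simp only [clamp]; omega
  constructor
  · rintro ⟨hc, h⟩
    exact topples_of_sum_compl_nonneg n K hK _ hone (hcube.1 hc) (hsum ▸ h)
  · rintro ⟨hc, h⟩
    refine ⟨hcube.2 hc, ?_⟩
    rw [hsum]
    rw [← Finset.sum_add_sum_compl K] at h
    have : ∑ i ∈ K, secondDiff i (odometer (n + 1) (2 * j) t) (clamp a x) ≤ 0 :=
      Finset.sum_nonpos fun i hi => by
        have h1 := odometer_add_single_le (n + 1) (2 * j) t (hone i hi).ge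
        have h2 := odometer_center_le (n + 1) (2 * j) t (hone i hi)
        simp only [secondDiff]; linarith
    linarith

theorem odometer_eq_clamp {n N j T : ℕ} {a : ℤ} (ha : 1 ≤ a) (hj : 1 ≤ j)
    (hM : (((N + 1) / 2 : ℕ) : ℤ) = a + j) (hT : ∀ s < T, line (2 * j) s j ≤ j - 1) (t : ℕ)
    (ht : t ≤ T) (x : Fin (n + 1) → ℤ) (hx : ∀ i, 1 ≤ x i) (hmax : ∃ i, a + 1 ≤ x i) :
    odometer (n + 1) N t x = odometer (n + 1) (2 * j) t (clamp a x) := by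
  induction t generalizing x with
  | zero => rfl
  | succ t ih =>
    have hgen : ∀ x : Fin (n + 1) → ℤ, (∀ i, 1 ≤ x i) → (∃ i, a + 1 ≤ x i) →
        (∀ i, x i = a + 1 → ∃ l, l ≠ i ∧ a + 1 ≤ x l) →
        odometer (n + 1) N (t + 1) x = odometer (n + 1) (2 * j) (t + 1) (clamp a x) := by
      intro x hx hmax hne
      have hiff := topples_clamp_iff ha hM (ih (by omega)) hx hmax hne
      have h0 := ih (by omega) x hx hmax
      by_cases h : Topples (n + 1) N t x
      · rw [odometer_succ_of_topples h, odometer_succ_of_topples (hiff.1 h), h0]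
      · rw [odometer_succ_of_not_topples h, odometer_succ_of_not_topples (mt hiff.2 h), h0]
    -- What remains is a single coordinate `a + 1` with all others at most `a`. Such a site lies
    -- between the site with `a + 1` in place `i` and `1` elsewhere, settled by dimension one, and
    -- `(a+1, …, a+1)`, settled by `hgen`. All three clamp to `(1, …, 1)`.
    by_cases hne : ∀ i, x i = a + 1 → ∃ l, l ≠ i ∧ a + 1 ≤ x l
    · exact hgen x hx hmax hne
    push Not at hne
    obtain ⟨i, hi, hl⟩ := hne
    have hz : clamp a x = Function.update (fun _ => 1) i 1 := by
      funext l
      by_cases h : l = i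
      · subst h; simp only [clamp, Function.update_self]; omega
      · have := hl l h; simp only [clamp, Function.update_of_ne h]; omega
    have hline := (line_selfSimilar ha hj hM hT (t + 1) ht).1 1 le_rfl
    have hupd : odometer (n + 1) N (t + 1) (Function.update (fun _ => 1) i (a + 1)) =
        odometer (n + 1) (2 * j) (t + 1) (clamp a x) := by
      rw [hz, odometer_update_one, odometer_update_one, add_comm a 1]
      exact hline
    by_cases hn : ∃ l, l ≠ i
    swap
    · push Not at hn
      rw [← hupd]
      congr 1
      funext l
      rw [hn l, hi, Function.update_self]
    refine le_antisymm ?_ ?_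
    · rw [← hupd]
      refine odometer_antitone (fun l => ?_) fun l => ?_
      · by_cases h : l = i
        · subst h; rw [Function.update_self]; omega
        · rw [Function.update_of_ne h]
      · by_cases h : l = i
        · subst h; rw [Function.update_self, hi]
        · rw [Function.update_of_ne h]; exact hx l
    · have hc : clamp a (fun _ : Fin (n + 1) => a + 1) = clamp a x := by
        rw [hz, Function.update_eq_self_iff.2 rfl]
        funext l
        simp [clamp]
      obtain ⟨l0, hl0⟩ := hn
      rw [← hc, ← hgen (fun _ => a + 1) (fun _ => by omega) ⟨i, le_rfl⟩ fun m _ => ?_]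
      · refine odometer_antitone hx fun l => ?_
        by_cases h : l = i
        · subst h; exact hi.le
        · linarith [hl l h]
      · by_cases h : m = i
        · exact ⟨l0, by rwa [h], le_rfl⟩
        · exact ⟨i, Ne.symm h, le_rfl⟩

/-! ### The time `τ_j` -/

theorem update_mem_cubeBoundary (n : ℕ) {j : ℕ} (hj : 1 ≤ j) :
    Function.update (fun _ => 1) 0 (j : ℤ) ∈ cubeBoundary (n + 1) (2 * j) := by
  refine ⟨fun l => ?_, Function.update (fun _ => 1) 0 (j : ℤ) + Pi.single 0 1, fun h => ?_, ?_⟩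
  · by_cases h : l = 0
    · subst h; simp only [Function.update_self]; omega
    · simp only [Function.update_of_ne h]; omega
  · have := h 0
    simp only [Pi.add_apply, Function.update_self, Pi.single_eq_same] at this
    omega
  · simp only [Pi.add_apply, add_sub_cancel_left]
    rw [Finset.sum_eq_single 0 (fun l _ h => by simp [h]) (by simp)]
    simp

/-- In a stable state every second difference on the interval is at most `-1`. Starting from slope
zero at the centre, the drop from `k` to `k + 1` is at least `k`, and the value at `j + 1` is zero.
-/
theorem le_line_of_stable {j t : ℕ} (ht : t ∈ stableTimes 1 (2 * j)) : (j : ℤ) ≤ line (2 * j) t j := by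
  have h : ∀ k : ℕ, k ≤ j → line (2 * j) t (k + 1) + k ≤ line (2 * j) t k := by
    intro k
    induction k with
    | zero => intro _; simpa using (line_center_even j t).ge
    | succ k ih =>
      intro hk
      have h1 := ih (by omega)
      have hnT : ¬ Topples 1 (2 * j) t fun _ => (k : ℤ) + 1 := fun hT => by
        have h2 := odometer_succ_of_topples hT
        rw [odometer_eq_of_stable ht] at h2
        linarith
      rw [topples_const, not_and, not_le] at hnT
      have h2 := hnT (by omega)
      rw [add_sub_cancel_right] at h2
      push_cast
      linarith
  have h1 := h j le_rfl
  rw [line_eq_zero (c := (j : ℤ) + 1) (by omega)] at h1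
  linarith

theorem boundaryTimes_nonempty (n : ℕ) {j : ℕ} (hj : 1 ≤ j) :
    (boundaryTimes (n + 1) j).Nonempty := by
  obtain ⟨t, ht⟩ := stableTimes_nonempty 1 (2 * j) le_rfl
  refine ⟨t + 1, Nat.succ_pos t, _, update_mem_cubeBoundary n hj, ?_⟩
  rw [odometer_update_one, odometer_eq_of_stable ht]
  exact le_line_of_stable ht

theorem line_lt_of_lt_tau {n j s : ℕ} (hj : 1 ≤ j) (hs : s < tau (n + 1) j) :
    line (2 * j) s j ≤ j - 1 := by
  obtain rfl | h0 := Nat.eq_zero_or_pos s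
  -- Time `0` is not among the boundary times, so minimality says nothing about it.
  · rw [line_zero]; omega
  · by_contra h
    refine Nat.notMem_of_lt_sInf hs ⟨h0, _, update_mem_cubeBoundary n hj, ?_⟩
    rw [odometer_update_one]
    change (j : ℤ) ≤ line (2 * j) s j
    linarith

theorem sandpile_selfSimilar {n N j t : ℕ} {a : ℤ} (ha : 1 ≤ a) (hj : 1 ≤ j)
    (hM : (((N + 1) / 2 : ℕ) : ℤ) = a + j) (ht : t ≤ tau (n + 1) j) {x : Fin (n + 1) → ℤ}
    (hx : ∀ i, a + 2 ≤ x i ∧ x i ≤ a + j) :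
    sandpile (n + 1) N t x = sandpile (n + 1) (2 * j) t fun i => x i - a := by
  have hz : (fun i => x i - a) = clamp a x := by
    funext i
    have := hx i
    simp only [clamp]; omega
  have hT : ∀ s < tau (n + 1) j, line (2 * j) s j ≤ j - 1 := fun s hs => line_lt_of_lt_tau hj hs
  have hodo : ∀ y : Fin (n + 1) → ℤ, (∀ i, a + 1 ≤ y i) → odometer (n + 1) N t y =
      odometer (n + 1) (2 * j) t (clamp a y) := fun y hy =>
    odometer_eq_clamp ha hj hM hT t ht y (fun i => by linarith [hy i]) ⟨0, hy 0⟩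
  rw [hz, sandpile_eq, sandpile_eq, laplacian_eq_sum, laplacian_eq_sum]
  · congr 1
    refine Finset.sum_congr rfl fun i _ => ?_
    have hi := hx i
    -- Coordinates at least `a + 2` keep all neighbours at `a + 1` or more, where the odometers
    -- agree and `clamp` is a plain translation.
    rw [secondDiff, secondDiff, hodo x fun l => by linarith [(hx l).1],
      hodo (x + Pi.single i 1), hodo (x - Pi.single i 1), clamp_add_single (by linarith),
      clamp_sub_single (by linarith)]
    · intro l
      have := hx l
      by_cases h : l = i
      · subst h; simp; omega
      · simp [h]; omega
    · intro l
      have := hx l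
      by_cases h : l = i
      · subst h; simp; omega
      · simp [h]; omega
  · intro i
    have := hx i
    simp only [clamp]; omega
  · intro i
    have := hx i
    omega

end Sandpile

theorem mainTheorem2 (n N M : ℕ) (hn : 1 ≤ n) (hN : 1 ≤ N) (hM : M = (N + 1) / 2) :
    -- dimensional reduction
    (∀ x ∈ Sandpile.sortedDomain n M, (∀ i, 2 ≤ x i) →
      Sandpile.terminalSandpile (n + 1) N (Fin.snoc (α := fun _ => ℤ) x 1) =
        Sandpile.terminalSandpile n N x + 2) ∧
    -- self-similarity, up to the (finite) time `τ_j`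
    (∀ j : ℕ, 1 ≤ j → j < M →
      (Sandpile.boundaryTimes (n + 1) j).Nonempty ∧
      ∀ t ≤ Sandpile.tau (n + 1) j, ∀ x ∈ Sandpile.sortedDomain (n + 1) M,
        (∀ i, (M : ℤ) - j + 1 < x i) →
          Sandpile.sandpile (n + 1) N t x =
            Sandpile.sandpile (n + 1) (2 * j) t (fun i => x i - ((M : ℤ) - j))) := by
  subst hM
  refine ⟨fun x hx h2 => ?_, fun j hj hjM =>
    ⟨Sandpile.boundaryTimes_nonempty n hj, fun t ht x hx hxi => ?_⟩⟩
  · rw [← Fin.insertNth_last']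
    refine Sandpile.terminalSandpile_ins_one hn (Fin.last n) (fun i => ?_) ⟨⟨0, hn⟩, h2 _⟩
    have := hx.1 i
    omega
  · refine Sandpile.sandpile_selfSimilar (by omega) hj (by ring) ht fun i => ?_
    have := hx.1 i
    have := hxi i
    omega
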